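/- Let $A,B,X$ be complex $n\times n$ matrices and let $M=\begin{bmatrix}A&X\\X^*&B\end{bmatrix}$ be the corresponding $2n\times 2n$ block matrix. For a square matrix $T$ let $W(T)=\{\langle Tx,x\rangle:\|x\|=1\}$ be its numerical range and $s_1(T)\ge s_2(T)\ge\cdots$ its singular values in decreasing order, counted with multiplicity. Call $T$ accretive if $\Re z\ge 0$ for all $z\in W(T)$. If $M$ is accretive, then $$2s_j(X)\le s_j(M),\qquad j=1,2,\dots,n.$$ Moreover, suppose that $M$ is APT (accretive partial transpose), that is, both $M$ and its partial transpose $M^\tau=\begin{bmatrix}A&X^*\\X&B\end{bmatrix}$ are accretive, and that, for some $\alpha\in[0,\pi/2)$, $W(M)\subseteq S_\alpha:=\{z\in\mathbb{C}:\Re z\ge 0,\ |\Im z|\le\tan(\alpha)\,\Re z\}$. Then $$2\|X\|_u\le\sec(\alpha)\,\|A+B\|_u$$ for every unitarily invariant norm $\|\cdot\|_u$ on the complex $n\times n$ matrices, i.e. every norm with $\|UTV\|_u=\|T\|_u$ for all matrices $T$ and all unitary $U,V$. -/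

import Mathlib

/-- The numerical range `W(A) = {⟨Ax, x⟩ : ‖x‖ = 1}` of a complex square matrix, for the Euclidean
inner product. Mathlib's `inner` is linear in its second argument, so `⟨Ax, x⟩`, linear in `Ax`,
is written `inner ℂ x (A x)`. -/
def numericalRange {ι : Type*} [Fintype ι] [DecidableEq ι] (A : Matrix ι ι ℂ) : Set ℂ :=
  {z | ∃ x : EuclideanSpace ℂ ι, ‖x‖ = 1 ∧ inner ℂ x (Matrix.toEuclideanLin A x) = z}

/-- A matrix is accretive if its numerical range lies in the closed right half plane. -/
def IsAccretive {ι : Type*} [Fintype ι] [DecidableEq ι] (A : Matrix ι ι ℂ) : Prop :=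
  numericalRange A ⊆ {z : ℂ | 0 ≤ z.re}

/-- The sector `S_α = {z : Re z ≥ 0, |Im z| ≤ tan α · Re z}`. -/
def sector (α : ℝ) : Set ℂ :=
  {z : ℂ | 0 ≤ z.re ∧ |z.im| ≤ Real.tan α * z.re}

/-- The partial transpose of a `2 × 2` block matrix: the two off-diagonal blocks are exchanged. -/
def partialTranspose {ι : Type*} (M : Matrix (ι ⊕ ι) (ι ⊕ ι) ℂ) : Matrix (ι ⊕ ι) (ι ⊕ ι) ℂ :=
  Matrix.fromBlocks M.toBlocks₁₁ M.toBlocks₂₁ M.toBlocks₁₂ M.toBlocks₂₂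

/-- A `2 × 2` block matrix is APT (accretive partial transpose) if it and its partial transpose
are both accretive. -/
def IsAPT {ι : Type*} [Fintype ι] [DecidableEq ι] (M : Matrix (ι ⊕ ι) (ι ⊕ ι) ℂ) : Prop :=
  IsAccretive M ∧ IsAccretive (partialTranspose M)

/-- The singular values of a matrix in decreasing order, with multiplicity, indexed from `0`:
`singularValue A j` is the `(j + 1)`-st largest singular value, and is `0` when `j` is at least the
size of the matrix. -/
noncomputable def singularValue {ι : Type*} [Fintype ι] [DecidableEq ι]
    (A : Matrix ι ι ℂ) (j : ℕ) : ℝ :=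
  (Matrix.toEuclideanLin A).singularValues j

/-- A seminorm `N` on square complex matrices is a unitarily invariant norm if it is definite and
`N (U A V) = N A` for all unitary `U`, `V`. -/
structure IsUnitarilyInvariantNorm {ι : Type*} [Fintype ι] [DecidableEq ι]
    (N : Seminorm ℂ (Matrix ι ι ℂ)) : Prop where
  definite : ∀ A : Matrix ι ι ℂ, N A = 0 → A = 0
  unitary_mul_mul : ∀ A U V : Matrix ι ι ℂ,
    U ∈ Matrix.unitaryGroup ι ℂ → V ∈ Matrix.unitaryGroup ι ℂ → N (U * A * V) = N A

/-! Accretivity says `Re⟨Au,u⟩ + Re⟨Bv,v⟩ + 2 Re⟨Xv,u⟩ ≥ 0` for all `u, v`. Let `W` be a unitary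
polar factor of `X`, so that `Re⟨Xv,Wv⟩ ≥ s_j(X)‖v‖²` on a space spanned by top right singular
vectors. Testing at `(-Wv, v)` bounds the diagonal terms below by `2 Re⟨Xv,Wv⟩`; hence the form of
`M` at `(Wv, v)` is at least `4 s_j(X)‖v‖²`, and min-max gives the first claim. For APT matrices,
adding the tests of `M` at `(-Wv, v)` and of its partial transpose at `(-v, Wv)` gives `s_j(4X) ≤
s_j(W*(A+B)W + (A+B))`. Unitarily invariant norms are monotone in singular values, so `4‖X‖ ≤
2‖A+B‖`; finally `sec α ≥ 1`. -/

open Module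

/-! ### Singular value decomposition and min-max bounds -/

section SingularValues

variable {𝕜 : Type*} [RCLike 𝕜]
  {E : Type*} [NormedAddCommGroup E] [InnerProductSpace 𝕜 E] [FiniteDimensional 𝕜 E]
  {F : Type*} [NormedAddCommGroup F] [InnerProductSpace 𝕜 F] [FiniteDimensional 𝕜 F]

/-- An orthonormal basis of right singular vectors, ordered by decreasing singular value. -/
theorem LinearMap.exists_orthonormalBasis_adjoint_apply_apply {n : ℕ} (T : E →ₗ[𝕜] F)
    (hE : finrank 𝕜 E = n) :
    ∃ b : OrthonormalBasis (Fin n) 𝕜 E, ∀ i,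
      (LinearMap.adjoint T) (T (b i)) = (T.singularValues i : 𝕜) ^ 2 • b i := by
  refine ⟨T.isSymmetric_adjoint_comp_self.eigenvectorBasis hE, fun i => ?_⟩
  have h := T.isSymmetric_adjoint_comp_self.apply_eigenvectorBasis hE i
  rw [← T.sq_singularValues_fin hE, RCLike.ofReal_pow] at h
  exact h

/-- Singular value decomposition of a linear map between spaces of the same dimension. -/
theorem LinearMap.exists_orthonormalBasis_apply_eq_singularValues_smul {n : ℕ} (T : E →ₗ[𝕜] F)
    (hE : finrank 𝕜 E = n) (hF : finrank 𝕜 F = n) :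
    ∃ (b : OrthonormalBasis (Fin n) 𝕜 E) (c : OrthonormalBasis (Fin n) 𝕜 F),
      ∀ i, T (b i) = (T.singularValues i : 𝕜) • c i := by
  obtain ⟨b, hb⟩ := T.exists_orthonormalBasis_adjoint_apply_apply hE
  have hinner : ∀ i k, inner 𝕜 (T (b i)) (T (b k))
      = if i = k then ((T.singularValues i : 𝕜)) ^ 2 else 0 := by
    intro i k
    rw [← LinearMap.adjoint_inner_right, hb, inner_smul_right,
      orthonormal_iff_ite.mp b.orthonormal i k]
    split_ifs with h <;> simp [h]
  -- Only images with nonzero singular value can be normalised. The remaining `c i` may be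
  -- arbitrary, since there `T (b i) = 0`.
  have hon : Orthonormal 𝕜 (Set.domRestrict {i : Fin n | T.singularValues i ≠ 0}
      fun i => ((T.singularValues i : 𝕜))⁻¹ • T (b i)) := by
    rw [orthonormal_iff_ite]
    rintro ⟨i, hi⟩ ⟨k, hk⟩
    have hi' : (T.singularValues i : 𝕜) ≠ 0 := by exact_mod_cast hi
    simp only [Set.domRestrict_apply, inner_smul_left, inner_smul_right, hinner, Subtype.mk.injEq]
    split_ifs with h
    · subst h
      simp only [map_inv₀, RCLike.conj_ofReal]
      field_simp
    · simp
  obtain ⟨c, hc⟩ := hon.exists_orthonormalBasis_extension_of_card_eq (by simpa using hF)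
  refine ⟨b, c, fun i => ?_⟩
  by_cases hi : T.singularValues i = 0
  · have := hinner i i
    simpa [hi] using this
  · have hi' : (T.singularValues i : 𝕜) ≠ 0 := by exact_mod_cast hi
    rw [hc i hi, smul_smul, mul_inv_cancel₀ hi', one_smul]

/-- A polar form of a linear map, with variational lower bounds for its singular values. -/
theorem LinearMap.exists_linearIsometryEquiv_singularValues_le {n : ℕ} (T : E →ₗ[𝕜] F)
    (hE : finrank 𝕜 E = n) (hF : finrank 𝕜 F = n) :
    ∃ W : E ≃ₗᵢ[𝕜] F, ∀ j < n, ∃ K : Submodule 𝕜 E, j < finrank 𝕜 K ∧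
      ∀ v ∈ K, T.singularValues j * ‖v‖ ^ 2 ≤ RCLike.re (inner 𝕜 (W v) (T v)) := by
  obtain ⟨b, c, hT⟩ := T.exists_orthonormalBasis_apply_eq_singularValues_smul hE hF
  refine ⟨b.equiv c (Equiv.refl _), fun j hj => ?_⟩
  -- The kernel of `p` is the span of `b 0, …, b j`; rank-nullity gives it dimension at least `n -
  -- (n - 1 - j) = j + 1`.
  let p : E →ₗ[𝕜] ({i : Fin n // j < i} → 𝕜) := LinearMap.pi fun i => b.toBasis.coord i
  have hcard : Fintype.card {i : Fin n // j < i} = n - 1 - j := by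
    have := Fin.card_Ioi (⟨j, hj⟩ : Fin n)
    rw [← this, Fintype.card_subtype]
    congr 1
    ext i
    simp [Fin.lt_def]
  refine ⟨LinearMap.ker p, ?_, fun v hv => ?_⟩
  · have h1 := p.finrank_range_add_finrank_ker
    have h2 := (LinearMap.range p).finrank_le
    rw [Module.finrank_fintype_fun_eq_card, hcard] at h2
    omega
  · have hv0 : ∀ i : Fin n, j < i → b.repr v i = 0 := by
      intro i hi
      have := congrFun (LinearMap.mem_ker.mp hv) ⟨i, hi⟩
      simpa [p] using this
    have hTv : T v = ∑ i, (b.repr v i * (T.singularValues i : 𝕜)) • c i := by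
      conv_lhs => rw [← b.sum_repr v]
      simp [map_sum, hT, smul_smul]
    have hWv : (b.equiv c (Equiv.refl _)) v = ∑ i, b.repr v i • c i := by
      conv_lhs => rw [← b.sum_repr v]
      simp [map_sum]
    have hin : RCLike.re (inner 𝕜 ((b.equiv c (Equiv.refl _)) v) (T v))
        = ∑ i : Fin n, T.singularValues i * ‖b.repr v i‖ ^ 2 := by
      rw [hTv, hWv, c.orthonormal.inner_sum, map_sum]
      refine Finset.sum_congr rfl fun i _ => ?_
      rw [← mul_assoc, RCLike.conj_mul]
      norm_cast
      rw [mul_comm]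
    have hnorm : ‖v‖ ^ 2 = ∑ i, ‖b.repr v i‖ ^ 2 := by
      rw [← b.repr.norm_map v, EuclideanSpace.norm_sq_eq]
    rw [hin, hnorm, Finset.mul_sum]
    refine Finset.sum_le_sum fun i _ => ?_
    by_cases hi : j < i
    · simp [hv0 i hi]
    · exact mul_le_mul_of_nonneg_right (T.singularValues_antitone (not_lt.mp hi)) (sq_nonneg _)

/-- The easy half of the min-max principle for singular values. -/
theorem LinearMap.le_singularValues_of_forall_le_norm {G : Type*} [AddCommGroup G] [Module 𝕜 G]
    [FiniteDimensional 𝕜 G] (T : E →ₗ[𝕜] F) (f : G →ₗ[𝕜] E) (hf : Function.Injective f)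
    {j : ℕ} (hj : j < finrank 𝕜 G) {r : ℝ} (h : ∀ x, r * ‖f x‖ ≤ ‖T (f x)‖) :
    r ≤ T.singularValues j := by
  have hle : finrank 𝕜 G ≤ finrank 𝕜 E := LinearMap.finrank_le_finrank_of_injective hf
  obtain ⟨b, hT⟩ := T.exists_orthonormalBasis_adjoint_apply_apply rfl
  -- Only `j` conditions on a space of dimension more than `j`: some nonzero `f x` lies in the span
  -- of the `b i` with `i ≥ j`, where `T` stretches by at most its singular value of index `j`.
  let p : G →ₗ[𝕜] (Fin j → 𝕜) :=
    LinearMap.pi fun i => b.toBasis.coord ⟨i, i.2.trans (hj.trans_le hle)⟩ ∘ₗ f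
  have hker : LinearMap.ker p ≠ ⊥ := LinearMap.ker_ne_bot_of_finrank_lt (by simpa using hj)
  obtain ⟨x, hx, hx0⟩ := Submodule.exists_mem_ne_zero_of_ne_bot hker
  set v := f x with hv
  have hv0 : v ≠ 0 := fun h0 => hx0 (hf (by rw [← hv, h0, map_zero]))
  have hvi : ∀ i : Fin (finrank 𝕜 E), (i : ℕ) < j → b.repr v i = 0 := by
    intro i hi
    have := congrFun (LinearMap.mem_ker.mp hx) ⟨i, hi⟩
    simpa [p] using this
  have hTv : (LinearMap.adjoint T) (T v)
      = ∑ i, (b.repr v i * (T.singularValues i : 𝕜) ^ 2) • b i := by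
    conv_lhs => rw [← b.sum_repr v]
    simp [map_sum, hT, smul_smul]
  have hin : ‖T v‖ ^ 2 = ∑ i : Fin (finrank 𝕜 E), T.singularValues i ^ 2 * ‖b.repr v i‖ ^ 2 := by
    rw [← inner_self_eq_norm_sq (𝕜 := 𝕜), ← LinearMap.adjoint_inner_right, hTv]
    nth_rewrite 1 [← b.sum_repr v]
    rw [b.orthonormal.inner_sum, map_sum]
    refine Finset.sum_congr rfl fun i _ => ?_
    rw [← mul_assoc, RCLike.conj_mul]
    norm_cast
    rw [mul_comm]
  have hnorm : ‖v‖ ^ 2 = ∑ i, ‖b.repr v i‖ ^ 2 := by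
    rw [← b.repr.norm_map v, EuclideanSpace.norm_sq_eq]
  have hle2 : ‖T v‖ ^ 2 ≤ (T.singularValues j * ‖v‖) ^ 2 := by
    rw [mul_pow, hin, hnorm, Finset.mul_sum]
    refine Finset.sum_le_sum fun i _ => ?_
    by_cases hi : (i : ℕ) < j
    · simp [hvi i hi]
    · exact mul_le_mul_of_nonneg_right (pow_le_pow_left₀ (T.singularValues_nonneg _)
        (T.singularValues_antitone (not_lt.mp hi)) 2) (sq_nonneg _)
  have hle3 : ‖T v‖ ≤ T.singularValues j * ‖v‖ := le_of_sq_le_sq hle2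
    (mul_nonneg (T.singularValues_nonneg _) (norm_nonneg _))
  exact le_of_mul_le_mul_right ((h x).trans hle3) (norm_pos_iff.mpr hv0)

/-- A lower bound for the real part of the quadratic form of a linear operator on a space of
dimension more than `j` bounds its singular value of index `j` from below. -/
theorem LinearMap.le_singularValues_of_forall_le_re_inner {G : Type*} [AddCommGroup G]
    [Module 𝕜 G] [FiniteDimensional 𝕜 G] (T : E →ₗ[𝕜] E) (f : G →ₗ[𝕜] E)
    (hf : Function.Injective f) {j : ℕ} (hj : j < finrank 𝕜 G) {r : ℝ}
    (h : ∀ x, r * ‖f x‖ ^ 2 ≤ RCLike.re (inner 𝕜 (f x) (T (f x)))) :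
    r ≤ T.singularValues j := by
  refine T.le_singularValues_of_forall_le_norm f hf hj fun x => ?_
  rcases eq_or_ne (f x) 0 with h0 | h0
  · simp [h0]
  · refine le_of_mul_le_mul_right ?_ (norm_pos_iff.mpr h0)
    calc r * ‖f x‖ * ‖f x‖ = r * ‖f x‖ ^ 2 := by ring
      _ ≤ _ := h x
      _ ≤ ‖f x‖ * ‖T (f x)‖ := re_inner_le_norm _ _
      _ = _ := mul_comm _ _

end SingularValues

/-! ### Monotonicity of unitarily invariant norms -/

section UnitarilyInvariantNorm

variable {n : ℕ} {N : Seminorm ℂ (Matrix (Fin n) (Fin n) ℂ)}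

/-- Singular value decomposition of a square matrix. -/
theorem Matrix.exists_unitary_mul_diagonal_singularValue_mul (A : Matrix (Fin n) (Fin n) ℂ) :
    ∃ U ∈ Matrix.unitaryGroup (Fin n) ℂ, ∃ V ∈ Matrix.unitaryGroup (Fin n) ℂ,
      A = U * Matrix.diagonal (fun i : Fin n => (singularValue A i : ℂ)) * V := by
  obtain ⟨b, c, h⟩ := (Matrix.toEuclideanLin A).exists_orthonormalBasis_apply_eq_singularValues_smul
    (finrank_euclideanSpace_fin (n := n)) finrank_euclideanSpace_fin
  set e := EuclideanSpace.basisFun (Fin n) ℂ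
  refine ⟨e.toBasis.toMatrix c, e.toMatrix_orthonormalBasis_mem_unitary c, b.toBasis.toMatrix e,
    b.toMatrix_orthonormalBasis_mem_unitary e, ?_⟩
  have hd : Matrix.diagonal (fun i : Fin n => (singularValue A i : ℂ))
      = LinearMap.toMatrix b.toBasis c.toBasis (Matrix.toEuclideanLin A) := by
    ext i k
    simp only [LinearMap.toMatrix_apply, OrthonormalBasis.coe_toBasis, h, map_smul,
      OrthonormalBasis.coe_toBasis_repr_apply, Finsupp.smul_apply, singularValue]
    rw [c.repr_self]
    by_cases hik : i = k
    · subst hik; simp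
    · simp [hik]
  have := basis_toMatrix_mul_linearMap_toMatrix_mul_basis_toMatrix e.toBasis b.toBasis e.toBasis
    c.toBasis (Matrix.toEuclideanLin A)
  rw [OrthonormalBasis.coe_toBasis, OrthonormalBasis.coe_toBasis] at this
  rw [hd, this, Matrix.toEuclideanLin_eq_toLin_orthonormal, LinearMap.toMatrix_toLin]

/-- A unitarily invariant norm does not increase under multiplication by a diagonal contraction. -/
theorem IsUnitarilyInvariantNorm.diagonal_mul_le (hN : IsUnitarilyInvariantNorm N) {d : Fin n → ℝ}
    (hd : ∀ i, |d i| ≤ 1) (A : Matrix (Fin n) (Fin n) ℂ) :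
    N (Matrix.diagonal (fun i => (d i : ℂ)) * A) ≤ N A := by
  have key : ∀ u : Fin n → ℂ, (∀ i, star (u i) * u i = 1) → N (Matrix.diagonal u * A) = N A := by
    intro u hu
    have h := hN.unitary_mul_mul A (Matrix.diagonal u) 1 (by
      rw [Matrix.mem_unitaryGroup_iff', Matrix.star_eq_conjTranspose, Matrix.diagonal_conjTranspose,
        Matrix.diagonal_mul_diagonal, ← Matrix.diagonal_one]
      exact congrArg _ (funext hu)) (one_mem _)
    rwa [mul_one] at h
  have hsq : ∀ i, d i ^ 2 + √(1 - d i ^ 2) ^ 2 = 1 := fun i => by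
    rw [Real.sq_sqrt (sub_nonneg.mpr ((sq_le_one_iff_abs_le_one _).mpr (hd i)))]
    ring
  -- Each `d i` is the mean of the unimodular numbers `d i ± i√(1 - d i ^ 2)`, so the contraction is
  -- the mean of two diagonal unitaries.
  have h1 := key (fun i => ⟨d i, √(1 - d i ^ 2)⟩) fun i => by
    have := hsq i
    apply Complex.ext <;> simp <;> linarith
  have h2 := key (fun i => ⟨d i, -√(1 - d i ^ 2)⟩) fun i => by
    have := hsq i
    apply Complex.ext <;> simp <;> linarith
  have hsum : (2 : ℂ) • (Matrix.diagonal (fun i => (d i : ℂ)) * A)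
      = Matrix.diagonal (fun i => (⟨d i, √(1 - d i ^ 2)⟩ : ℂ)) * A
        + Matrix.diagonal (fun i => (⟨d i, -√(1 - d i ^ 2)⟩ : ℂ)) * A := by
    rw [← add_mul, Matrix.diagonal_add, ← smul_mul_assoc, ← Matrix.diagonal_smul]
    congr 2
    funext i
    apply Complex.ext <;> simp
    ring
  have h3 := map_add_le_add N (Matrix.diagonal (fun i => (⟨d i, √(1 - d i ^ 2)⟩ : ℂ)) * A)
    (Matrix.diagonal (fun i => (⟨d i, -√(1 - d i ^ 2)⟩ : ℂ)) * A)
  rw [← hsum, map_smul_eq_mul, h1, h2] at h3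
  norm_num at h3
  linarith

/-- Unitarily invariant norms are monotone in the singular values. -/
theorem IsUnitarilyInvariantNorm.le_of_singularValue_le (hN : IsUnitarilyInvariantNorm N)
    {S T : Matrix (Fin n) (Fin n) ℂ} (h : ∀ j : Fin n, singularValue S j ≤ singularValue T j) :
    N S ≤ N T := by
  obtain ⟨U, hU, V, hV, hS⟩ := S.exists_unitary_mul_diagonal_singularValue_mul
  obtain ⟨U', hU', V', hV', hT⟩ := T.exists_unitary_mul_diagonal_singularValue_mul
  have h0 : ∀ j, 0 ≤ singularValue S j := fun j => LinearMap.singularValues_nonneg _ _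
  -- Where the singular value of `T` vanishes, so does that of `S`, and the quotient is `0` by
  -- convention.
  have hdiag : Matrix.diagonal (fun i : Fin n => (singularValue S i : ℂ))
      = Matrix.diagonal (fun i : Fin n => ((singularValue S i / singularValue T i : ℝ) : ℂ))
        * Matrix.diagonal (fun i : Fin n => (singularValue T i : ℂ)) := by
    rw [Matrix.diagonal_mul_diagonal]
    congr 1
    funext i
    norm_cast
    rcases eq_or_ne (singularValue T i) 0 with h1 | h1
    · rw [h1, mul_zero]
      exact le_antisymm (h1 ▸ h i) (h0 i)
    · rw [div_mul_cancel₀ _ h1]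
  rw [hS, hT, hN.unitary_mul_mul _ _ _ hU hV, hN.unitary_mul_mul _ _ _ hU' hV', hdiag]
  refine hN.diagonal_mul_le (fun i => ?_) _
  have hT0 := (h0 i).trans (h i)
  rw [abs_of_nonneg (div_nonneg (h0 i) hT0)]
  exact div_le_one_of_le₀ (h i) hT0

end UnitarilyInvariantNorm

/-! ### Accretive block matrices -/

section Accretive

theorem IsAccretive.re_inner_nonneg {ι : Type*} [Fintype ι] [DecidableEq ι] {M : Matrix ι ι ℂ}
    (hM : IsAccretive M) (x : EuclideanSpace ℂ ι) :
    0 ≤ (inner ℂ x (Matrix.toEuclideanLin M x)).re := by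
  rcases eq_or_ne x 0 with h0 | h0
  · simp [h0]
  · have hx : (‖x‖ : ℂ) ≠ 0 := by exact_mod_cast norm_ne_zero_iff.mpr h0
    have h : 0 ≤ (inner ℂ ((‖x‖ : ℂ)⁻¹ • x)
        (Matrix.toEuclideanLin M ((‖x‖ : ℂ)⁻¹ • x))).re :=
      hM ⟨_, norm_smul_inv_norm h0, rfl⟩
    rw [map_smul, inner_smul_left, inner_smul_right, map_inv₀, Complex.conj_ofReal,
      ← Complex.ofReal_inv, Complex.re_ofReal_mul, Complex.re_ofReal_mul] at h
    have hpos : 0 < ‖x‖⁻¹ := inv_pos.mpr (norm_pos_iff.mpr h0)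
    exact nonneg_of_mul_nonneg_right (nonneg_of_mul_nonneg_right h hpos) hpos

variable {n : ℕ}

/-- The vector of `ℂⁿ ⊕ ℂⁿ` with components `u` and `v`. -/
noncomputable def EuclideanSpace.sumElim (ι κ : Type*) :
    EuclideanSpace ℂ ι × EuclideanSpace ℂ κ →ₗ[ℂ] EuclideanSpace ℂ (ι ⊕ κ) where
  toFun p := WithLp.toLp 2 (Sum.elim p.1 p.2)
  map_add' p q := by ext (i | i) <;> simp
  map_smul' a p := by ext (i | i) <;> simp

theorem EuclideanSpace.inner_sumElim {ι κ : Type*} [Fintype ι] [Fintype κ]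
    (p q : EuclideanSpace ℂ ι × EuclideanSpace ℂ κ) :
    inner ℂ (sumElim ι κ p) (sumElim ι κ q) = inner ℂ p.1 q.1 + inner ℂ p.2 q.2 := by
  simp [sumElim, PiLp.inner_apply]

theorem EuclideanSpace.norm_sq_sumElim {ι κ : Type*} [Fintype ι] [Fintype κ]
    (p : EuclideanSpace ℂ ι × EuclideanSpace ℂ κ) :
    ‖sumElim ι κ p‖ ^ 2 = ‖p.1‖ ^ 2 + ‖p.2‖ ^ 2 := by
  simp [sumElim, EuclideanSpace.norm_sq_eq]

theorem Matrix.toEuclideanLin_fromBlocks_sumElim {ι κ : Type*} [Fintype ι] [Fintype κ]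
    [DecidableEq ι] [DecidableEq κ] (A : Matrix ι ι ℂ) (B : Matrix ι κ ℂ) (C : Matrix κ ι ℂ)
    (D : Matrix κ κ ℂ) (p : EuclideanSpace ℂ ι × EuclideanSpace ℂ κ) :
    Matrix.toEuclideanLin (Matrix.fromBlocks A B C D) (EuclideanSpace.sumElim ι κ p)
      = EuclideanSpace.sumElim ι κ
        (Matrix.toEuclideanLin A p.1 + Matrix.toEuclideanLin B p.2,
          Matrix.toEuclideanLin C p.1 + Matrix.toEuclideanLin D p.2) := by
  ext (i | i) <;>
    simp [EuclideanSpace.sumElim, Matrix.toLpLin_apply, Matrix.fromBlocks_mulVec]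

/-- The real part of the quadratic form of a block matrix with mutually adjoint off-diagonal
blocks. -/
theorem Matrix.re_inner_fromBlocks_conjTranspose {ι : Type*} [Fintype ι] [DecidableEq ι]
    (A B X : Matrix ι ι ℂ) (u v : EuclideanSpace ℂ ι) :
    (inner ℂ (EuclideanSpace.sumElim ι ι (u, v))
      (Matrix.toEuclideanLin (Matrix.fromBlocks A X X.conjTranspose B)
        (EuclideanSpace.sumElim ι ι (u, v)))).re
      = (inner ℂ u (Matrix.toEuclideanLin A u)).re + (inner ℂ v (Matrix.toEuclideanLin B v)).re
        + 2 * (inner ℂ u (Matrix.toEuclideanLin X v)).re := by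
  have h : (inner ℂ v (Matrix.toEuclideanLin X.conjTranspose u)).re
      = (inner ℂ u (Matrix.toEuclideanLin X v)).re := by
    rw [Matrix.toEuclideanLin_conjTranspose_eq_adjoint, LinearMap.adjoint_inner_right]
    exact inner_re_symm (𝕜 := ℂ) _ _
  rw [Matrix.toEuclideanLin_fromBlocks_sumElim, EuclideanSpace.inner_sumElim]
  simp only [inner_add_right, Complex.add_re, h]
  ring

theorem two_mul_singularValue_le_of_isAccretive {A B X : Matrix (Fin n) (Fin n) ℂ}
    (hM : IsAccretive (Matrix.fromBlocks A X X.conjTranspose B)) (j : Fin n) :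
    2 * singularValue X j ≤ singularValue (Matrix.fromBlocks A X X.conjTranspose B) j := by
  obtain ⟨W, hW⟩ := (Matrix.toEuclideanLin X).exists_linearIsometryEquiv_singularValues_le
    (finrank_euclideanSpace_fin (n := n)) finrank_euclideanSpace_fin
  obtain ⟨K, hK, hv⟩ := hW j j.2
  let f : K →ₗ[ℂ] EuclideanSpace ℂ (Fin n ⊕ Fin n) := EuclideanSpace.sumElim (Fin n) (Fin n) ∘ₗ
    (W.toLinearEquiv.toLinearMap ∘ₗ K.subtype).prod K.subtype
  have hf : ∀ x : K, f x = EuclideanSpace.sumElim (Fin n) (Fin n) (W x, (x : EuclideanSpace ℂ _)) :=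
    fun x => rfl
  have hnorm : ∀ x : K, ‖f x‖ ^ 2 = 2 * ‖(x : EuclideanSpace ℂ (Fin n))‖ ^ 2 := fun x => by
    rw [hf, EuclideanSpace.norm_sq_sumElim, W.norm_map]
    ring
  refine LinearMap.le_singularValues_of_forall_le_re_inner _ f
    ((injective_iff_map_eq_zero f).mpr fun x hx => ?_) hK fun x => ?_
  · have := hnorm x
    rw [hx] at this
    simpa using this
  -- Flipping the sign of `W x` reverses only the cross term, so the diagonal terms dominate it.
  · have h1 := hM.re_inner_nonneg (EuclideanSpace.sumElim (Fin n) (Fin n) (-W x, (x : _)))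
    rw [Matrix.re_inner_fromBlocks_conjTranspose] at h1
    have h2 := hv x x.2
    rw [hnorm, hf, RCLike.re_to_complex, Matrix.re_inner_fromBlocks_conjTranspose]
    simp only [map_neg, inner_neg_left, inner_neg_right, neg_neg, Complex.neg_re] at h1
    rw [RCLike.re_to_complex] at h2
    unfold singularValue
    linarith

/-- For an APT block matrix, the off-diagonal block is dominated in every unitarily invariant norm
by the sum of the diagonal blocks. -/
theorem IsAPT.two_mul_le {A B X : Matrix (Fin n) (Fin n) ℂ}
    (hM : IsAPT (Matrix.fromBlocks A X X.conjTranspose B))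
    {N : Seminorm ℂ (Matrix (Fin n) (Fin n) ℂ)} (hN : IsUnitarilyInvariantNorm N) :
    2 * N X ≤ N (A + B) := by
  obtain ⟨hM1, hM2⟩ := hM
  have hpt : partialTranspose (Matrix.fromBlocks A X X.conjTranspose B)
      = Matrix.fromBlocks A X.conjTranspose X.conjTranspose.conjTranspose B := by
    simp [partialTranspose]
  rw [hpt] at hM2
  -- Each of the two accretivity tests contributes `2 Re⟨Xv,Wv⟩`, hence the factor `4`.
  set Y := (4 : ℂ) • X with hY
  obtain ⟨W, hW⟩ := (Matrix.toEuclideanLin Y).exists_linearIsometryEquiv_singularValues_le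
    (finrank_euclideanSpace_fin (n := n)) finrank_euclideanSpace_fin
  let e := EuclideanSpace.basisFun (Fin n) ℂ
  set U : Matrix (Fin n) (Fin n) ℂ := LinearMap.toMatrix e.toBasis e.toBasis W.toLinearMap with hUdef
  have hU : U ∈ Matrix.unitaryGroup (Fin n) ℂ := W.toMatrix_mem_unitaryGroup e e
  have hUW : ∀ x, Matrix.toEuclideanLin U x = W x := fun x => by
    rw [hUdef, Matrix.toEuclideanLin_eq_toLin_orthonormal, Matrix.toLin_toMatrix]
    rfl
  have hle : N Y ≤ N (star U * (A + B) * U + (A + B)) := by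
    refine hN.le_of_singularValue_le fun j => ?_
    obtain ⟨K, hK, hv⟩ := hW j j.2
    refine LinearMap.le_singularValues_of_forall_le_re_inner _ K.subtype K.subtype_injective hK
      fun x => (hv x x.2).trans ?_
    rw [Submodule.subtype_apply]
    generalize (x : EuclideanSpace ℂ (Fin n)) = v
    have h1 := hM1.re_inner_nonneg (EuclideanSpace.sumElim (Fin n) (Fin n) (-W v, v))
    -- Swapping the roles of `v` and `W v` pairs `A` with `v` and `B` with `W v`, so that adding
    -- `h1` completes both forms to `A + B`.
    have h2 := hM2.re_inner_nonneg (EuclideanSpace.sumElim (Fin n) (Fin n) (-v, W v))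
    rw [Matrix.re_inner_fromBlocks_conjTranspose] at h1 h2
    rw [Matrix.toEuclideanLin_conjTranspose_eq_adjoint, LinearMap.adjoint_inner_right] at h2
    have h3 : (inner ℂ (Matrix.toEuclideanLin X v) (W v)).re
        = (inner ℂ (W v) (Matrix.toEuclideanLin X v)).re := inner_re_symm (𝕜 := ℂ) _ _
    have hQ : Matrix.toEuclideanLin (star U * (A + B) * U + (A + B)) v
        = LinearMap.adjoint (Matrix.toEuclideanLin U) (Matrix.toEuclideanLin (A + B) (W v))
          + Matrix.toEuclideanLin (A + B) v := by
      rw [← hUW, ← Matrix.toEuclideanLin_conjTranspose_eq_adjoint]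
      simp [Matrix.toLpLin_apply, Matrix.mulVec_mulVec, mul_assoc,
        Matrix.star_eq_conjTranspose]
    rw [hQ, inner_add_right, LinearMap.adjoint_inner_right, hUW, hY]
    simp only [map_neg, map_add, map_smul, LinearMap.add_apply, LinearMap.smul_apply,
      inner_neg_left, inner_neg_right, inner_add_right, inner_smul_right, neg_neg, Complex.neg_re,
      RCLike.re_to_complex, Complex.mul_re, Complex.re_ofNat, Complex.im_ofNat,
      zero_mul, sub_zero] at h1 h2 ⊢
    linarith
  have htri := hle.trans (map_add_le_add N _ _)
  rw [hN.unitary_mul_mul _ _ _ (Unitary.star_mem hU) hU, hY, map_smul_eq_mul] at htri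
  norm_num at htri
  linarith

end Accretive

theorem mainTheorem5 (n : ℕ) (A B X : Matrix (Fin n) (Fin n) ℂ)
    (hM : IsAccretive (Matrix.fromBlocks A X X.conjTranspose B)) :
    (∀ j : Fin n,
      2 * singularValue X j ≤ singularValue (Matrix.fromBlocks A X X.conjTranspose B) j) ∧
    (IsAPT (Matrix.fromBlocks A X X.conjTranspose B) →
      ∀ α : ℝ, 0 ≤ α → α < Real.pi / 2 →
        numericalRange (Matrix.fromBlocks A X X.conjTranspose B) ⊆ sector α →
        ∀ N : Seminorm ℂ (Matrix (Fin n) (Fin n) ℂ), IsUnitarilyInvariantNorm N →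
          2 * N X ≤ (1 / Real.cos α) * N (A + B)) := by
  refine ⟨two_mul_singularValue_le_of_isAccretive hM, fun hAPT α h0 hα _ N hN => ?_⟩
  have hcos : 0 < Real.cos α := Real.cos_pos_of_mem_Ioo ⟨by linarith [Real.pi_pos], hα⟩
  exact (hAPT.two_mul_le hN).trans
    (le_mul_of_one_le_left (apply_nonneg N _) (one_le_one_div hcos (Real.cos_le_one α)))
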